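/- Let $k$ be a field, $n\ge 1$, $S=k[x_1,\ldots,x_n]$, and let $M\subseteq S$ be a monomial ideal with minimal generating set of monomials $G$. Let $$\mathbb F:\ \cdots\to F_i\to F_{i-1}\to\cdots\to F_1\to F_0\to S/M\to 0$$ be a minimal multigraded free resolution of $S/M$ with a chosen homogeneous basis of each $F_i$. Minimal means that no entry of the matrix of a differential $F_{i}\to F_{i-1}$, $i\ge1$, is invertible. A basis element $[\sigma]$ of $F_i$ has homological degree $\mathrm{hdeg}[\sigma]=i$, and its multidegree $\mathrm{mdeg}[\sigma]$ is a monomial of $S$. A finite set $L$ of monomials is *dominant* if for every $m\in L$ there is a variable $x$ whose exponent in $m$ is larger than its exponent in each $m'\in L\setminus\{m\}$. A monomial $x_1^{\alpha_1}\cdots x_n^{\alpha_n}$ *strongly divides* $x_1^{\beta_1}\cdots x_n^{\beta_n}$ if $\alpha_i<\beta_i$ whenever $\alpha_i\ne0$. 1. If $[\sigma]$ is a basis element of $\mathbb F$ with $\mathrm{hdeg}[\sigma]=n$, then there is a subset $L\subseteq G$ such that $L$ is dominant, $\#L=n$, $\mathrm{lcm}(L)=\mathrm{mdeg}[\sigma]$,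 and no element of $G$ strongly divides $\mathrm{lcm}(L)$. 2. Conversely, if $L\subseteq G$ is dominant, $\#L=n$, and no element of $G$ strongly divides $\mathrm{lcm}(L)$, then there is a basis element $[\sigma]$ of $\mathbb F$ with $\mathrm{hdeg}[\sigma]=n$ and $\mathrm{mdeg}[\sigma]=\mathrm{lcm}(L)$, and every basis element $[\tau]\neq[\sigma]$ of $\mathbb F$, in any homological degree, satisfies $\mathrm{mdeg}[\tau]\ne\mathrm{lcm}(L)$. -/

import Mathlib

/-! Monomials `x₁^{α₁} ⋯ xₙ^{αₙ}` of `k[x₁, …, xₙ]` are written as their exponent vectors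
`α : Fin n →₀ ℕ`: the product of monomials is `+`, divisibility is `≤`, and the least common
multiple is `⊔`. -/

universe w u

namespace MonomialRes

/-- The ideal of `k[x₁, …, xₙ]` generated by a set of monomials. -/
noncomputable def monomialIdeal (k : Type*) [Field k] {n : ℕ} (G : Set (Fin n →₀ ℕ)) :
    Ideal (MvPolynomial (Fin n) k) :=
  Ideal.span ((fun m => MvPolynomial.monomial m (1 : k)) '' G)

/-- `M` is minimally generated by the set of monomials `G`: the set `G` generates `M`, and no
proper subset of `G` does. -/
def IsMinimallyGeneratedBy {k : Type*} [Field k] {n : ℕ} (M : Ideal (MvPolynomial (Fin n) k))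
    (G : Finset (Fin n →₀ ℕ)) : Prop :=
  monomialIdeal k (G : Set (Fin n →₀ ℕ)) = M ∧
    ∀ G' : Finset (Fin n →₀ ℕ), G' ⊂ G → monomialIdeal k (G' : Set (Fin n →₀ ℕ)) ≠ M

/-- The least common multiple of a finite set of monomials (the monomial `1` for the empty set). -/
noncomputable def lcm {n : ℕ} (L : Finset (Fin n →₀ ℕ)) : Fin n →₀ ℕ :=
  L.sup id

/-- `m` is a dominant monomial in `L`: it lies in `L`, and some variable `x` appears in `m` with a
larger exponent than in every other element of `L`. -/
def IsDominantMonomial {n : ℕ} (L : Finset (Fin n →₀ ℕ)) (m : Fin n →₀ ℕ) : Prop :=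
  m ∈ L ∧ ∃ x : Fin n, ∀ m' ∈ L, m' ≠ m → m' x < m x

/-- `L` is a dominant set: each of its monomials is dominant in `L`. -/
def IsDominantSet {n : ℕ} (L : Finset (Fin n →₀ ℕ)) : Prop :=
  ∀ m ∈ L, IsDominantMonomial L m

/-- `l` strongly divides `l'`: the exponent of each variable that appears in `l` is smaller than
its exponent in `l'`. -/
def StronglyDivides {n : ℕ} (l l' : Fin n →₀ ℕ) : Prop :=
  ∀ i : Fin n, l i ≠ 0 → l i < l' i

/-- A multigraded free resolution `⋯ → F₂ → F₁ → F₀ → S/M → 0` of `S/M`, `S = k[x₁, …, xₙ]`, with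
a chosen homogeneous basis `basis i` of each `Fᵢ`. No finiteness of ranks or of the length is
imposed. -/
structure FreeResolution {k : Type u} [Field k] {n : ℕ}
    (M : Ideal (MvPolynomial (Fin n) k)) where
  /-- the basis elements of homological degree `i` -/
  basis : ℕ → Type w
  /-- the multidegree of a basis element -/
  mdeg : ∀ {i : ℕ}, basis i → (Fin n →₀ ℕ)
  /-- the differential `Fᵢ₊₁ → Fᵢ` -/
  d : ∀ i : ℕ, (basis (i + 1) →₀ MvPolynomial (Fin n) k) →ₗ[MvPolynomial (Fin n) k]
    (basis i →₀ MvPolynomial (Fin n) k)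
  /-- the augmentation `F₀ → S/M` -/
  aug : (basis 0 →₀ MvPolynomial (Fin n) k) →ₗ[MvPolynomial (Fin n) k]
    (MvPolynomial (Fin n) k ⧸ M)
  /-- exactness at `S/M` -/
  aug_surjective : Function.Surjective aug
  /-- exactness at `F₀` -/
  exact_zero : Function.Exact (d 0) aug
  /-- exactness at `Fᵢ₊₁` -/
  exact_succ : ∀ i : ℕ, Function.Exact (d (i + 1)) (d i)
  /-- the differentials preserve multidegrees: in `d [σ] = ∑ a_τ [τ]`, every monomial `e` of the
  coefficient `a_τ` satisfies `e · mdeg [τ] = mdeg [σ]` -/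
  d_homogeneous : ∀ (i : ℕ) (σ : basis (i + 1)) (τ : basis i),
    ∀ e ∈ (d i (Finsupp.single σ 1) τ).support, e + mdeg τ = mdeg σ
  /-- the augmentation preserves multidegrees: `[σ]` goes to the class of a scalar multiple of the
  monomial `mdeg [σ]` -/
  aug_homogeneous : ∀ σ : basis 0, ∃ c : k,
    aug (Finsupp.single σ 1) = Ideal.Quotient.mk M (MvPolynomial.monomial (mdeg σ) c)

/-- The resolution is minimal: no entry of a differential matrix is invertible. -/
def FreeResolution.IsMinimal {k : Type*} [Field k] {n : ℕ}
    {M : Ideal (MvPolynomial (Fin n) k)} (F : FreeResolution M) : Prop :=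
  ∀ (i : ℕ) (σ : F.basis (i + 1)) (τ : F.basis i), ¬ IsUnit (F.d i (Finsupp.single σ 1) τ)

end MonomialRes

/-! Write e_j for the exponent vector of x_j and 1 for (1,…,1). By minimality the differential of
F/(x_1,…,x_n)F is zero, so the basis elements of homological degree i and multidegree β form a basis
of its homology in degree (i, β). This homology is computed by killing the variables one at a time.
In multidegree β, F becomes the span of the basis elements whose multidegree divides β, with scalar
matrices as differentials, and (x_j : j ∈ T)F becomes the span of those with exponent below that of
β at some j ∈ T. Multiplication by x_j becomes an inclusion of spans, and its long exact sequence
relates T at β, T at β - e_j and T ∪ {j} at β.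

Starting from H_0(F) = S/M, two facts result. Homology in degree n at β forces β = γ + 1 with x^γ a
socle monomial of S/M: x^γ ∉ M, but x_j x^γ ∈ M for all j (`exists_of_not_koszulAcyclicAt_insert`,
`IsMinimal.exists_socle`). Conversely, at such a β the homology is one-dimensional and sits in
degree n only (`koszul_of_socle`).

Socle monomials match dominant sets (`exists_dominant_of_socle`, `exists_socle_of_dominant`): a
generator dividing x_j x^γ but not x^γ exceeds γ at x_j alone, n such generators have lcm γ + 1, and
a generator strongly divides γ + 1 exactly when it divides γ. -/

namespace MonomialRes

/-! ### Homology of quotients of subcomplexes. -/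

section RelativeHomology

variable {k : Type*} [Field k] {V : ℕ → Type*} [∀ i, AddCommGroup (V i)] [∀ i, Module k (V i)]

/-- The quotient `X / Y` of subcomplexes of `(V, d)` has no homology at `V (i + 1)`. -/
def RelAcyclicAt (d : ∀ i, V (i + 1) →ₗ[k] V i) (X Y : ∀ i, Submodule k (V i)) (i : ℕ) : Prop :=
  ∀ z ∈ X (i + 1), d i z ∈ Y i → ∃ w ∈ X (i + 2), z - d (i + 1) w ∈ Y (i + 1)

/-- The homology of the quotient `X / Y` of subcomplexes of `(V, d)` at `V (i + 1)` is
one-dimensional. -/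
def RelOneDimAt (d : ∀ i, V (i + 1) →ₗ[k] V i) (X Y : ∀ i, Submodule k (V i)) (i : ℕ) : Prop :=
  ∃ z ∈ X (i + 1), d i z ∈ Y i ∧ (∀ w ∈ X (i + 2), z - d (i + 1) w ∉ Y (i + 1)) ∧
    ∀ y ∈ X (i + 1), d i y ∈ Y i →
      ∃ c : k, ∃ w ∈ X (i + 2), y - c • z - d (i + 1) w ∈ Y (i + 1)

variable {d : ∀ i, V (i + 1) →ₗ[k] V i} {X Y X' : ∀ i, Submodule k (V i)}

/-- Vanishing in the long exact sequence of `X' / (X' ⊓ Y) → X / Y → X / (X' ⊔ Y)`, from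
injectivity of the first map on homology. -/
theorem RelAcyclicAt.of_injective (hd : ∀ i z, d i (d (i + 1) z) = 0)
    (hX' : ∀ i, ∀ z ∈ X' (i + 1), d i z ∈ X' i) (hY : ∀ i, ∀ z ∈ Y (i + 1), d i z ∈ Y i)
    (hle : X' ≤ X) {i : ℕ} (h : RelAcyclicAt d X Y (i + 1))
    (hinj : ∀ a ∈ X' (i + 1), d i a ∈ X' i ⊓ Y i → (∃ z ∈ X (i + 2), a - d (i + 1) z ∈ Y (i + 1)) →
      ∃ w ∈ X' (i + 2), a - d (i + 1) w ∈ X' (i + 1) ⊓ Y (i + 1)) :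
    RelAcyclicAt d X (X' ⊔ Y) (i + 1) := by
  intro z hz hdz
  obtain ⟨a, ha, y, hy, hay⟩ := Submodule.mem_sup.1 hdz
  have hda : d i a = - d i y := by
    have := hd i z
    rw [← hay, map_add] at this
    exact eq_neg_of_add_eq_zero_left this
  obtain ⟨w, hw, haw⟩ := hinj a ha
    ⟨hX' _ _ ha, by rw [hda]; exact neg_mem (hY _ _ hy)⟩
    ⟨z, hz, by rw [← hay]; simpa using hy⟩
  obtain ⟨v, hv, hvY⟩ := h (z - w) (sub_mem hz (hle _ hw)) (by
    have : d (i + 1) (z - w) = (a - d (i + 1) w) + y := by rw [map_sub, ← hay]; abel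
    rw [this]
    exact add_mem haw.2 hy)
  refine ⟨v, hv, Submodule.mem_sup.2 ⟨w, hw, _, hvY, by abel⟩⟩

theorem RelAcyclicAt.of_acyclic (hd : ∀ i z, d i (d (i + 1) z) = 0)
    (hX' : ∀ i, ∀ z ∈ X' (i + 1), d i z ∈ X' i) (hY : ∀ i, ∀ z ∈ Y (i + 1), d i z ∈ Y i)
    (hle : X' ≤ X) {i : ℕ} (h : RelAcyclicAt d X Y (i + 1))
    (h' : RelAcyclicAt d X' (X' ⊓ Y) i) :
    RelAcyclicAt d X (X' ⊔ Y) (i + 1) :=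
  .of_injective hd hX' hY hle h fun a ha hda _ => h' a ha hda

/-- With `V 0` zero every element of `X 1` is a cycle, so enlarging `Y` can only make the vanishing
easier. -/
theorem RelAcyclicAt.zero_sup [Subsingleton (V 0)] (h : RelAcyclicAt d X Y 0) :
    RelAcyclicAt d X (X' ⊔ Y) 0 := by
  intro z hz _
  obtain ⟨w, hw, hwY⟩ := h z hz (by rw [Subsingleton.elim (d 0 z) 0]; exact zero_mem _)
  exact ⟨w, hw, (le_sup_right : Y 1 ≤ X' 1 ⊔ Y 1) hwY⟩

/-- The connecting map of the long exact sequence of `X' / (X' ⊓ Y) → X / Y → X / (X' ⊔ Y)` is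
an isomorphism if `X / Y` is acyclic. -/
theorem RelOneDimAt.succ_sup (hd : ∀ i z, d i (d (i + 1) z) = 0)
    (hX' : ∀ i, ∀ z ∈ X' (i + 1), d i z ∈ X' i) (hY : ∀ i, ∀ z ∈ Y (i + 1), d i z ∈ Y i)
    (hle : X' ≤ X) {i : ℕ} (h₀ : RelAcyclicAt d X Y i) (h : RelAcyclicAt d X Y (i + 1))
    (h' : RelOneDimAt d X' (X' ⊓ Y) i) :
    RelOneDimAt d X (X' ⊔ Y) (i + 1) := by
  obtain ⟨z, hz, hdz, hzb, hgen⟩ := h'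
  -- The class of `z` dies in `X / Y`; the chain `w` bounding it is its preimage under the
  -- connecting map.
  obtain ⟨w, hw, hzw⟩ := h₀ z (hle _ hz) hdz.2
  refine ⟨w, hw, Submodule.mem_sup.2 ⟨z, hz, _, neg_mem hzw, by abel⟩, ?_, ?_⟩
  · intro v hv hwv
    obtain ⟨a, ha, y, hy, hay⟩ := Submodule.mem_sup.1 hwv
    have hdw : d (i + 1) w = d (i + 1) a + d (i + 1) y := by
      rw [← map_add, hay, map_sub, hd, sub_zero]
    refine hzb a ha ⟨sub_mem hz (hX' _ _ ha), ?_⟩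
    have : z - d (i + 1) a = (z - d (i + 1) w) + d (i + 1) y := by rw [hdw]; abel
    rw [this]
    exact add_mem hzw (hY _ _ hy)
  · intro u hu hdu
    obtain ⟨a, ha, y, hy, hay⟩ := Submodule.mem_sup.1 hdu
    have hda : d i a = - d i y := by
      have := hd i u
      rw [← hay, map_add] at this
      exact eq_neg_of_add_eq_zero_left this
    obtain ⟨c, b, hb, hab⟩ := hgen a ha ⟨hX' _ _ ha, by rw [hda]; exact neg_mem (hY _ _ hy)⟩
    obtain ⟨v, hv, hvY⟩ := h (u - c • w - b)
      (sub_mem (sub_mem hu (Submodule.smul_mem _ _ hw)) (hle _ hb)) (by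
        have : d (i + 1) (u - c • w - b) =
            (a - c • z - d (i + 1) b) + y + c • (z - d (i + 1) w) := by
          rw [map_sub, map_sub, map_smul, ← hay, smul_sub]; abel
        rw [this]
        exact add_mem (add_mem hab.2 hy) (Submodule.smul_mem _ _ hzw))
    exact ⟨c, v, hv, Submodule.mem_sup.2 ⟨b, hb, _, hvY, by abel⟩⟩

end RelativeHomology

/-! ### Homogeneous maps of free modules and their scalar matrices. -/

section Strands

open MvPolynomial

variable {k : Type*} [Field k] {n : ℕ} {B B' : Type*} (deg : B → Fin n →₀ ℕ)
  (deg' : B' → Fin n →₀ ℕ)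

/-- The part of multidegree `β` of an element of the free module on a basis with multidegrees
`deg`, as a combination of the basis elements of multidegree dividing `β`. -/
noncomputable def strandProj (k : Type*) [Field k] (β : Fin n →₀ ℕ) :
    (B →₀ MvPolynomial (Fin n) k) →ₗ[k] (B →₀ k) :=
  Finsupp.lsum k fun σ => Finsupp.lsingle σ ∘ₗ
    (open Classical in if deg σ ≤ β then lcoeff k (β - deg σ) else 0)

/-- The element of multidegree `β` with given coefficients. -/
noncomputable def homogenize (k : Type*) [Field k] (β : Fin n →₀ ℕ) :
    (B →₀ k) →ₗ[k] (B →₀ MvPolynomial (Fin n) k) :=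
  Finsupp.lsum k fun σ => Finsupp.lsingle σ ∘ₗ monomial (β - deg σ)

/-- The matrix of coefficients of a homogeneous map of free modules. -/
noncomputable def dehomogenize
    (f : (B →₀ MvPolynomial (Fin n) k) →ₗ[MvPolynomial (Fin n) k] (B' →₀ MvPolynomial (Fin n) k)) :
    (B →₀ k) →ₗ[k] (B' →₀ k) :=
  Finsupp.linearCombination k fun σ => strandProj deg' k (deg σ) (f (Finsupp.single σ 1))

variable {deg deg'}

open Classical in
theorem strandProj_single (β : Fin n →₀ ℕ) (σ : B) (p : MvPolynomial (Fin n) k) :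
    strandProj deg k β (Finsupp.single σ p) =
      Finsupp.single σ (if deg σ ≤ β then p.coeff (β - deg σ) else 0) := by
  simp only [strandProj, Finsupp.lsum_single, LinearMap.comp_apply, Finsupp.lsingle_apply]
  split_ifs <;> simp

open Classical in
theorem strandProj_apply (β : Fin n →₀ ℕ) (x : B →₀ MvPolynomial (Fin n) k) (σ : B) :
    strandProj deg k β x σ = if deg σ ≤ β then (x σ).coeff (β - deg σ) else 0 := by
  induction x using Finsupp.induction_linear with
  | zero => simp
  | add x y hx hy => rw [map_add, Finsupp.add_apply, hx, hy]; split_ifs <;> simp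
  | single τ p =>
    rw [strandProj_single]
    by_cases h : τ = σ
    · subst h; simp
    · simp [h]

theorem homogenize_single (β : Fin n →₀ ℕ) (σ : B) (c : k) :
    homogenize deg k β (Finsupp.single σ c) = Finsupp.single σ (monomial (β - deg σ) c) := by
  simp [homogenize]

theorem homogenize_apply (β : Fin n →₀ ℕ) (z : B →₀ k) (σ : B) :
    homogenize deg k β z σ = monomial (β - deg σ) (z σ) := by
  classical
  induction z using Finsupp.induction_linear with
  | zero => simp
  | add x y hx hy => rw [map_add, Finsupp.add_apply, hx, hy]; simp
  | single τ p =>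
    rw [homogenize_single]
    by_cases h : τ = σ
    · subst h; simp
    · simp [h]

theorem strandProj_mem (β : Fin n →₀ ℕ) (x : B →₀ MvPolynomial (Fin n) k) :
    strandProj deg k β x ∈ Finsupp.supported k k {σ | deg σ ≤ β} := by
  classical
  rw [Finsupp.mem_supported']
  intro σ hσ
  rw [strandProj_apply, if_neg (show ¬ deg σ ≤ β from hσ)]

theorem strandProj_homogenize {β : Fin n →₀ ℕ} {z : B →₀ k}
    (hz : z ∈ Finsupp.supported k k {σ | deg σ ≤ β}) :
    strandProj deg k β (homogenize deg k β z) = z := by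
  classical
  ext σ
  rw [strandProj_apply, homogenize_apply]
  split_ifs with h
  · simp
  · exact ((Finsupp.mem_supported' k z).1 hz σ h).symm

variable {f : (B →₀ MvPolynomial (Fin n) k) →ₗ[MvPolynomial (Fin n) k]
  (B' →₀ MvPolynomial (Fin n) k)}

theorem dehomogenize_single (σ : B) :
    dehomogenize deg deg' f (Finsupp.single σ 1) =
      strandProj deg' k (deg σ) (f (Finsupp.single σ 1)) := by
  simp [dehomogenize]

/-- Homogeneity leaves only one possible monomial in each matrix entry, so the scalar coefficients
determine the map. -/
theorem apply_single_eq (hf : ∀ σ τ, ∀ e ∈ (f (Finsupp.single σ 1) τ).support, e + deg' τ = deg σ)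
    (σ : B) : f (Finsupp.single σ 1) =
      homogenize deg' k (deg σ) (dehomogenize deg deg' f (Finsupp.single σ 1)) := by
  classical
  ext τ e
  rw [homogenize_apply, dehomogenize_single, strandProj_apply, coeff_monomial]
  by_cases he : e ∈ (f (Finsupp.single σ 1) τ).support
  · have := hf σ τ e he
    have h1 : deg' τ ≤ deg σ := this ▸ le_add_self
    have h2 : deg σ - deg' τ = e := by rw [← this, add_tsub_cancel_right]
    rw [if_pos h2, if_pos h1, h2]
  · rw [notMem_support_iff.1 he]
    split_ifs with h1 h2
    · rw [h1, notMem_support_iff.1 he]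
    · rfl
    · rfl

theorem strandProj_map
    (hf : ∀ σ τ, ∀ e ∈ (f (Finsupp.single σ 1) τ).support, e + deg' τ = deg σ)
    (β : Fin n →₀ ℕ) (x : B →₀ MvPolynomial (Fin n) k) :
    strandProj deg' k β (f x) = dehomogenize deg deg' f (strandProj deg k β x) := by
  classical
  induction x using Finsupp.induction_linear with
  | zero => simp
  | add x y hx hy => simp only [map_add, hx, hy]
  | single σ p =>
    induction p using MvPolynomial.induction_on' with
    | add p q hp hq => simp only [Finsupp.single_add, map_add, hp, hq]
    | monomial e c =>
      have h1 : (Finsupp.single σ (monomial e c) : B →₀ MvPolynomial (Fin n) k) =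
          monomial e c • Finsupp.single σ 1 := by simp
      rw [h1, map_smul, ← h1, strandProj_single]
      ext τ
      rw [apply_single_eq hf σ, strandProj_apply, Finsupp.smul_apply, homogenize_apply,
        smul_eq_mul, monomial_mul, coeff_monomial, coeff_monomial]
      have h2 : ∀ a : k, dehomogenize deg deg' f (Finsupp.single σ a) τ =
          a * dehomogenize deg deg' f (Finsupp.single σ 1) τ := by
        intro a
        rw [← mul_one a, ← smul_eq_mul, ← Finsupp.smul_single, map_smul, Finsupp.smul_apply,
          smul_eq_mul, smul_eq_mul, mul_one]
      rw [h2 (if deg σ ≤ β then if e = β - deg σ then c else 0 else 0)]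
      -- Subtraction of exponents is truncated, so divisibility has to be separated out. If `deg' τ`
      -- does not divide `deg σ` the matrix entry is zero; otherwise both sides vanish unless `e +
      -- deg σ = β`.
      by_cases hτ : deg' τ ≤ deg σ
      · by_cases he : e + deg σ = β
        · subst he
          have h3 : e + (deg σ - deg' τ) = e + deg σ - deg' τ := (add_tsub_assoc_of_le hτ e).symm
          have h4 : deg' τ ≤ e + deg σ := hτ.trans le_add_self
          simp [h3, h4]
        · have h3 : ¬ (deg' τ ≤ β ∧ e + (deg σ - deg' τ) = β - deg' τ) := by
            rintro ⟨h5, h6⟩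
            apply he
            rw [← add_tsub_assoc_of_le hτ] at h6
            rw [← tsub_add_cancel_of_le h5, ← h6, tsub_add_cancel_of_le (hτ.trans le_add_self)]
          have h4 : ¬ (deg σ ≤ β ∧ e = β - deg σ) := by
            rintro ⟨h5, h6⟩
            exact he (by rw [h6, tsub_add_cancel_of_le h5])
          rw [← ite_and, ← ite_and, if_neg h3, if_neg h4, zero_mul]
      · have h3 : dehomogenize deg deg' f (Finsupp.single σ 1) τ = 0 := by
          rw [dehomogenize_single, strandProj_apply, if_neg hτ]
        simp [h3]

/-- The support condition keeps the truncated exponents `β - deg σ` honest. -/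
theorem map_homogenize
    (hf : ∀ σ τ, ∀ e ∈ (f (Finsupp.single σ 1) τ).support, e + deg' τ = deg σ)
    {β : Fin n →₀ ℕ} {z : B →₀ k} (hz : z ∈ Finsupp.supported k k {σ | deg σ ≤ β}) :
    f (homogenize deg k β z) = homogenize deg' k β (dehomogenize deg deg' f z) := by
  classical
  rw [Finsupp.supported_eq_span_single] at hz
  induction hz using Submodule.span_induction with
  | zero => simp
  | add x y _ _ hx hy => simp only [map_add, hx, hy]
  | smul c x _ hx =>
    rw [map_smul, LinearMap.map_smul_of_tower, map_smul, hx, map_smul]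
  | mem x hx =>
    obtain ⟨σ, hσ, rfl⟩ := hx
    rw [homogenize_single]
    have h1 : (Finsupp.single σ (monomial (β - deg σ) 1) : B →₀ MvPolynomial (Fin n) k) =
        monomial (β - deg σ) (1 : k) • Finsupp.single σ 1 := by simp
    rw [h1, map_smul, apply_single_eq hf σ]
    ext1 τ
    rw [Finsupp.smul_apply, homogenize_apply, homogenize_apply, smul_eq_mul, monomial_mul, one_mul]
    by_cases hτ : deg' τ ≤ deg σ
    · have hσ' : deg σ ≤ β := hσ
      rw [← add_tsub_assoc_of_le hτ, tsub_add_cancel_of_le hσ']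
    · have h3 : dehomogenize deg deg' f (Finsupp.single σ 1) τ = 0 := by
        rw [dehomogenize_single, strandProj_apply, if_neg hτ]
      simp [h3]

/-- Membership of a dehomogenized map in a span of basis elements is checked on its matrix
entries, which vanish unless the multidegree of the target divides that of the source. -/
theorem dehomogenize_mem_supported {P Q : Set (Fin n →₀ ℕ)}
    (hPQ : ∀ σ τ, deg σ ∈ P → deg' τ ≤ deg σ →
      dehomogenize deg deg' f (Finsupp.single σ 1) τ ≠ 0 → deg' τ ∈ Q)
    {z : B →₀ k} (hz : z ∈ Finsupp.supported k k {σ | deg σ ∈ P}) :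
    dehomogenize deg deg' f z ∈ Finsupp.supported k k {τ | deg' τ ∈ Q} := by
  classical
  rw [Finsupp.supported_eq_span_single] at hz
  induction hz using Submodule.span_induction with
  | zero => simp
  | add x y _ _ hx hy => rw [map_add]; exact add_mem hx hy
  | smul c x _ hx => rw [map_smul]; exact Submodule.smul_mem _ _ hx
  | mem x hx =>
    obtain ⟨σ, hσ, rfl⟩ := hx
    rw [Finsupp.mem_supported']
    intro τ hτ
    by_contra h0
    refine hτ (hPQ σ τ hσ ?_ h0)
    by_contra h1
    exact h0 (by rw [dehomogenize_single, strandProj_apply, if_neg h1])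

end Strands

end MonomialRes

/-! ### The multidegree strands of a resolution and their homology. -/

namespace MonomialRes

open MvPolynomial

variable {k : Type u} [Field k] {n : ℕ} {M : Ideal (MvPolynomial (Fin n) k)}

theorem monomialIdeal_coeff {G : Finset (Fin n →₀ ℕ)} (hG : monomialIdeal k (G : Set _) = M)
    {p : MvPolynomial (Fin n) k} (hp : p ∈ M) {β : Fin n →₀ ℕ} (hβ : p.coeff β ≠ 0) :
    ∃ g ∈ G, g ≤ β := by
  rw [← hG, monomialIdeal, mem_ideal_span_monomial_image] at hp
  simpa using hp β (mem_support_iff.2 hβ)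

theorem monomial_mem_iff {G : Finset (Fin n →₀ ℕ)} (hG : monomialIdeal k (G : Set _) = M)
    {β : Fin n →₀ ℕ} : monomial β (1 : k) ∈ M ↔ ∃ g ∈ G, g ≤ β := by
  classical
  refine ⟨fun h => monomialIdeal_coeff hG h (by simp), ?_⟩
  rintro ⟨g, hg, hle⟩
  rw [← hG, monomialIdeal, mem_ideal_span_monomial_image]
  intro x hx
  have := support_monomial_subset hx
  rw [Finset.mem_singleton.1 this]
  exact ⟨g, hg, hle⟩

namespace FreeResolution

/-- The basis elements, indexed by homological degree plus one. -/
def shiftedBasis (F : FreeResolution.{w, u} M) : ℕ → Type w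
  | 0 => PEmpty
  | i + 1 => F.basis i

/-- The multidegree of a basis element. -/
def shiftedMdeg (F : FreeResolution.{w, u} M) : ∀ i, F.shiftedBasis i → Fin n →₀ ℕ
  | 0 => fun σ => PEmpty.elim σ
  | i + 1 => fun σ : F.basis i => F.mdeg σ

/-- The coefficients of the differentials. -/
noncomputable def coeffD (F : FreeResolution.{w, u} M) :
    ∀ i, (F.shiftedBasis (i + 1) →₀ k) →ₗ[k] (F.shiftedBasis i →₀ k)
  | 0 => 0
  | i + 1 => dehomogenize (B := F.basis (i + 1)) (B' := F.basis i) F.mdeg F.mdeg (F.d i)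

/-- The combinations of the basis elements with multidegree in `P`. -/
def strand (F : FreeResolution.{w, u} M) (P : Set (Fin n →₀ ℕ)) (i : ℕ) :
    Submodule k (F.shiftedBasis i →₀ k) :=
  Finsupp.supported k k {σ | F.shiftedMdeg i σ ∈ P}

variable (F : FreeResolution.{w, u} M)

/-- The zero level below `F₀` makes homology at index 0 the cokernel of `F₁ → F₀`; the augmentation
stays outside the complex. -/
instance : Subsingleton (F.shiftedBasis 0 →₀ k) :=
  haveI : IsEmpty (F.shiftedBasis 0) := inferInstanceAs (IsEmpty PEmpty)
  inferInstance

theorem strand_mono {P Q : Set (Fin n →₀ ℕ)} (h : P ⊆ Q) : F.strand P ≤ F.strand Q :=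
  fun _ => Finsupp.supported_mono fun _ hσ => h hσ

theorem strand_sup (P Q : Set (Fin n →₀ ℕ)) : F.strand P ⊔ F.strand Q = F.strand (P ∪ Q) :=
  funext fun _ => (Finsupp.supported_union _ _).symm

theorem strand_inf (P Q : Set (Fin n →₀ ℕ)) : F.strand P ⊓ F.strand Q = F.strand (P ∩ Q) :=
  funext fun _ => (Finsupp.supported_inter _ _).symm

theorem d_comp_d (i : ℕ) (x) : F.d i (F.d (i + 1) x) = 0 :=
  (F.exact_succ i).apply_apply_eq_zero x

theorem coeffD_comp_coeffD :
    ∀ i z, F.coeffD i (F.coeffD (i + 1) z) = 0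
  | 0, _ => rfl
  | i + 1, z => by
    have : dehomogenize (B := F.basis (i + 1)) (B' := F.basis i) F.mdeg F.mdeg (F.d i) ∘ₗ
        dehomogenize (B := F.basis (i + 2)) (B' := F.basis (i + 1)) F.mdeg F.mdeg (F.d (i + 1)) =
        0 := by
      refine Finsupp.lhom_ext' fun σ => LinearMap.ext_ring ?_
      simp only [LinearMap.comp_apply, Finsupp.lsingle_apply, LinearMap.zero_apply]
      rw [dehomogenize_single, ← strandProj_map (F.d_homogeneous i), F.d_comp_d, map_zero]
    exact LinearMap.congr_fun this z

theorem coeffD_mem_strand {P : Set (Fin n →₀ ℕ)} (hP : IsLowerSet P) :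
    ∀ i, ∀ z ∈ F.strand P (i + 1), F.coeffD i z ∈ F.strand P i
  | 0, _, _ => zero_mem _
  | _ + 1, _, hz => dehomogenize_mem_supported (fun _ _ hσ hle _ => hP hle hσ) hz

variable {F} in
theorem IsMinimal.coeffD_mem_strand (hF : F.IsMinimal) {P Q : Set (Fin n →₀ ℕ)}
    (hPQ : ∀ γ ∈ P, ∀ γ' < γ, γ' ∈ Q) :
    ∀ i, ∀ z ∈ F.strand P (i + 1), F.coeffD i z ∈ F.strand Q i
  | 0, _, _ => zero_mem _
  | i + 1, _, hz => by
    refine dehomogenize_mem_supported (fun σ (τ : F.basis i) hσ hle h0 => hPQ _ hσ _ (lt_of_le_of_ne hle ?_)) hz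
    -- A nonzero entry between equal multidegrees would be a nonzero constant, hence a unit.
    intro (heq : F.mdeg τ = F.mdeg σ)
    apply hF i σ τ
    rw [apply_single_eq (F.d_homogeneous i) σ, homogenize_apply, ← heq, tsub_self]
    exact (isUnit_iff_ne_zero.2 h0).map C

/-- Exactness of F restricts to multidegree β: homogenize a cycle, lift it along the differential,
and keep the degree-β part of the lift. -/
theorem relAcyclicAt_Iic (β : Fin n →₀ ℕ) (i : ℕ) :
    RelAcyclicAt F.coeffD (F.strand (Set.Iic β)) (F.strand ∅) (i + 1) := by
  intro (z : F.basis (i + 1) →₀ k) hz hdz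
  have hz' : z ∈ Finsupp.supported k k {σ : F.basis (i + 1) | F.mdeg σ ≤ β} := hz
  have hdz' : dehomogenize (B := F.basis (i + 1)) (B' := F.basis i) F.mdeg F.mdeg (F.d i) z = 0 := by
    have h : F.strand ∅ (i + 1) = ⊥ := Finsupp.supported_empty
    rw [h] at hdz
    exact (Submodule.mem_bot k).1 hdz
  obtain ⟨x, hx⟩ := (F.exact_succ i (homogenize F.mdeg k β z)).1 (by
    rw [map_homogenize (F.d_homogeneous i) hz', hdz', map_zero])
  refine ⟨strandProj (B := F.basis (i + 2)) F.mdeg k β x, strandProj_mem _ _, ?_⟩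
  have : z = dehomogenize (B := F.basis (i + 2)) (B' := F.basis (i + 1)) F.mdeg F.mdeg (F.d (i + 1))
      (strandProj (B := F.basis (i + 2)) F.mdeg k β x) := by
    rw [← strandProj_map (F.d_homogeneous (i + 1)), hx, strandProj_homogenize hz']
  have h2 : ∀ a b : F.shiftedBasis (i + 2) →₀ k, a = b → a - b ∈ F.strand ∅ (i + 2) := by
    rintro a _ rfl
    rw [sub_self]
    exact zero_mem _
  exact h2 _ _ this

/-- The coefficients of the augmentation. -/
noncomputable def augCoeff : (F.basis 0 →₀ k) →ₗ[k] k :=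
  Finsupp.linearCombination k fun σ => (F.aug_homogeneous σ).choose

theorem aug_homogenize {β : Fin n →₀ ℕ} {z : F.basis 0 →₀ k}
    (hz : z ∈ Finsupp.supported k k {σ : F.basis 0 | F.mdeg σ ≤ β}) :
    F.aug (homogenize F.mdeg k β z) = Ideal.Quotient.mk M (monomial β (F.augCoeff z)) := by
  classical
  rw [Finsupp.supported_eq_span_single] at hz
  induction hz using Submodule.span_induction with
  | zero => simp
  | add x y _ _ hx hy => simp only [map_add, hx, hy]
  | smul c x _ hx =>
    rw [map_smul, LinearMap.map_smul_of_tower, map_smul, hx, map_smul]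
    rfl
  | mem x hx =>
    obtain ⟨σ, hσ, rfl⟩ := hx
    rw [homogenize_single]
    have h1 : (Finsupp.single σ (monomial (β - F.mdeg σ) 1) :
        F.basis 0 →₀ MvPolynomial (Fin n) k) =
        monomial (β - F.mdeg σ) (1 : k) • Finsupp.single σ 1 := by simp
    have hσ' : F.mdeg σ ≤ β := hσ
    rw [h1, map_smul, (F.aug_homogeneous σ).choose_spec]
    simp only [augCoeff, Finsupp.linearCombination_single, one_smul]
    rw [← Ideal.Quotient.mk_eq_mk, ← Submodule.Quotient.mk_smul, smul_eq_mul, monomial_mul,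
      one_mul, tsub_add_cancel_of_le hσ', Ideal.Quotient.mk_eq_mk]

/-- With `monomial_augCoeff_coeffD`, this identifies the homology at index 0 in multidegree β with
(S/M)_β, which is 0 or k. -/
theorem mem_range_coeffD {β : Fin n →₀ ℕ} {z : F.basis 0 →₀ k}
    (hz : z ∈ Finsupp.supported k k {σ : F.basis 0 | F.mdeg σ ≤ β})
    (h : monomial β (F.augCoeff z) ∈ M) :
    ∃ w ∈ F.strand (Set.Iic β) 2, F.coeffD 1 w = z := by
  obtain ⟨x, hx⟩ := (F.exact_zero (homogenize F.mdeg k β z)).1 (by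
    rw [F.aug_homogenize hz]; exact Ideal.Quotient.eq_zero_iff_mem.2 h)
  refine ⟨strandProj (B := F.basis 1) F.mdeg k β x, strandProj_mem _ _, ?_⟩
  change dehomogenize (B := F.basis 1) (B' := F.basis 0) F.mdeg F.mdeg (F.d 0)
      (strandProj (B := F.basis 1) F.mdeg k β x) = z
  rw [← strandProj_map (F.d_homogeneous 0), hx, strandProj_homogenize hz]

theorem monomial_augCoeff_coeffD {β : Fin n →₀ ℕ} {w : F.basis 1 →₀ k}
    (hw : w ∈ F.strand (Set.Iic β) 2) :
    monomial β (F.augCoeff (F.coeffD 1 w)) ∈ M := by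
  have hw' : w ∈ Finsupp.supported k k {σ : F.basis 1 | F.mdeg σ ≤ β} := hw
  rw [← Ideal.Quotient.eq_zero_iff_mem, ← F.aug_homogenize (β := β)
    (F.coeffD_mem_strand (isLowerSet_Iic β) 1 w hw)]
  change F.aug (homogenize F.mdeg k β (dehomogenize (B := F.basis 1) (B' := F.basis 0)
    F.mdeg F.mdeg (F.d 0) w)) = 0
  rw [← map_homogenize (F.d_homogeneous 0) hw']
  exact F.exact_zero.apply_apply_eq_zero _

theorem monomial_mem_of_mem {β : Fin n →₀ ℕ} (h : monomial β (1 : k) ∈ M) (c : k) :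
    monomial β c ∈ M := by
  have := M.mul_mem_left (C c) h
  rwa [C_mul_monomial, mul_one] at this

theorem eq_zero_of_monomial_mem {β : Fin n →₀ ℕ} (h : monomial β (1 : k) ∉ M) {c : k}
    (hc : monomial β c ∈ M) : c = 0 := by
  by_contra h0
  apply h
  have := M.mul_mem_left (C c⁻¹) hc
  rwa [C_mul_monomial, inv_mul_cancel₀ h0] at this

theorem relAcyclicAt_zero_Iic {β : Fin n →₀ ℕ} (h : monomial β (1 : k) ∈ M) :
    RelAcyclicAt F.coeffD (F.strand (Set.Iic β)) (F.strand ∅) 0 := by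
  intro z hz _
  obtain ⟨w, hw, rfl⟩ := F.mem_range_coeffD hz (monomial_mem_of_mem h _)
  exact ⟨w, hw, by rw [sub_self]; exact zero_mem _⟩

theorem exists_augCoeff_eq_one {G : Finset (Fin n →₀ ℕ)}
    (hG : monomialIdeal k (G : Set _) = M) {β : Fin n →₀ ℕ}
    (h : monomial β (1 : k) ∉ M) :
    ∃ z ∈ F.strand (Set.Iic β) 1, F.augCoeff z = 1 := by
  classical
  suffices h : ∃ σ : F.basis 0, F.mdeg σ ≤ β ∧ (F.aug_homogeneous σ).choose ≠ 0 by
    obtain ⟨σ, hσ, hc⟩ := h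
    refine ⟨Finsupp.single σ (F.aug_homogeneous σ).choose⁻¹,
      Finsupp.single_mem_supported _ _ hσ, ?_⟩
    exact (Finsupp.linearCombination_single k _ σ).trans (inv_mul_cancel₀ hc)
  by_contra! hcon
  -- If no basis element of multidegree dividing β has nonzero augmentation, every class in S/M has
  -- a representative without the monomial x^β; for the class of x^β itself this puts x^β in M.
  have key : ∀ x : F.basis 0 →₀ MvPolynomial (Fin n) k, ∃ p : MvPolynomial (Fin n) k,
      F.aug x = Ideal.Quotient.mk M p ∧ p.coeff β = 0 := by
    intro x
    induction x using Finsupp.induction_linear with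
    | zero => exact ⟨0, by simp, by simp⟩
    | add x y hx hy =>
      obtain ⟨p, hp, hp'⟩ := hx
      obtain ⟨q, hq, hq'⟩ := hy
      exact ⟨p + q, by rw [map_add, hp, hq, map_add], by rw [coeff_add, hp', hq', add_zero]⟩
    | single σ q =>
      refine ⟨q * monomial (F.mdeg σ) (F.aug_homogeneous σ).choose, ?_, ?_⟩
      · have h1 : (Finsupp.single σ q : F.basis 0 →₀ MvPolynomial (Fin n) k) =
          q • Finsupp.single σ 1 := by simp
        have h2 := (F.aug_homogeneous σ).choose_spec
        rw [h1, map_smul]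
        refine (congrArg (q • ·) h2).trans ?_
        change q • Ideal.Quotient.mk M _ = _
        rw [← Ideal.Quotient.mk_eq_mk,
          ← Submodule.Quotient.mk_smul, smul_eq_mul, Ideal.Quotient.mk_eq_mk]
      · rw [coeff_mul_monomial']
        split_ifs with hle
        · rw [hcon σ hle, mul_zero]
        · rfl
  obtain ⟨x, hx⟩ := F.aug_surjective (Ideal.Quotient.mk M (monomial β 1))
  obtain ⟨p, hp, hp'⟩ := key x
  have hmem : monomial β (1 : k) - p ∈ M := Ideal.Quotient.eq.1 (hx.symm.trans hp)
  exact h ((monomial_mem_iff hG).2 (monomialIdeal_coeff hG hmem (by simp [hp'])))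

theorem relOneDimAt_zero_Iic {G : Finset (Fin n →₀ ℕ)}
    (hG : monomialIdeal k (G : Set _) = M) {β : Fin n →₀ ℕ} (h : monomial β (1 : k) ∉ M) :
    RelOneDimAt F.coeffD (F.strand (Set.Iic β)) (F.strand ∅) 0 := by
  obtain ⟨z, hz, hz1⟩ := F.exists_augCoeff_eq_one hG h
  have hbot : F.strand ∅ 1 = ⊥ := Finsupp.supported_empty
  refine ⟨z, hz, zero_mem _, ?_, ?_⟩
  · intro w hw hzw
    rw [hbot] at hzw
    have h1 : z = F.coeffD 1 w := sub_eq_zero.1 ((Submodule.mem_bot k).1 hzw)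
    have h2 := F.monomial_augCoeff_coeffD hw
    rw [← h1, hz1] at h2
    exact h h2
  · intro y hy _
    obtain ⟨w, hw, hwy⟩ := F.mem_range_coeffD (β := β) (z := y - F.augCoeff y • z)
      (sub_mem hy (Submodule.smul_mem _ _ hz)) (by
        have : ∀ y z : F.basis 0 →₀ k, F.augCoeff z = 1 →
            F.augCoeff (y - F.augCoeff y • z) = 0 := by
          intro y z h
          rw [map_sub, map_smul, h, smul_eq_mul, mul_one, sub_self]
        have h0 := congrArg (monomial β) (this y z hz1)
        rw [map_zero] at h0
        exact (congrArg (· ∈ M) h0).mpr (zero_mem _))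
    refine ⟨F.augCoeff y, w, hw, ?_⟩
    have h2 : y - F.augCoeff y • z - F.coeffD 1 w = 0 := sub_eq_zero.2 hwy.symm
    exact h2 ▸ zero_mem (F.strand ∅ 1)

end FreeResolution

end MonomialRes

/-! ### Killing variables: Koszul homology one multidegree at a time. -/

namespace MonomialRes

open MvPolynomial

variable {n : ℕ}

/-- The squarefree monomial with support `T`. -/
noncomputable def squarefreeMonomial (T : Finset (Fin n)) : Fin n →₀ ℕ :=
  ∑ j ∈ T, Finsupp.single j 1

theorem squarefreeMonomial_apply (T : Finset (Fin n)) (i : Fin n) [Decidable (i ∈ T)] :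
    squarefreeMonomial T i = if i ∈ T then 1 else 0 := by
  classical
  simp [squarefreeMonomial, Finsupp.finsetSum_apply, Finsupp.single_apply]

theorem squarefreeMonomial_insert {T : Finset (Fin n)} {j : Fin n} (hj : j ∉ T) :
    squarefreeMonomial (insert j T) = Finsupp.single j 1 + squarefreeMonomial T :=
  Finset.sum_insert hj

/-- The multidegrees dividing `β` with smaller exponent than `β` at a variable of `T`. -/
def belowAt (T : Finset (Fin n)) (β : Fin n →₀ ℕ) : Set (Fin n →₀ ℕ) :=
  {γ | γ ≤ β ∧ ∃ j ∈ T, γ j < β j}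

theorem belowAt_empty (β : Fin n →₀ ℕ) : belowAt ∅ β = ∅ := by
  simp [belowAt]

theorem isLowerSet_belowAt (T : Finset (Fin n)) (β : Fin n →₀ ℕ) : IsLowerSet (belowAt T β) := by
  rintro γ γ' hle ⟨h, j, hj, hlt⟩
  exact ⟨hle.trans h, j, hj, (hle j).trans_lt hlt⟩

theorem lt_iff_mem_belowAt_univ {γ β : Fin n →₀ ℕ} : γ ∈ belowAt Finset.univ β ↔ γ < β := by
  rw [belowAt, lt_iff_le_not_ge]
  refine and_congr_right fun h => ?_
  rw [Finsupp.le_def]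
  push Not
  simp

theorem belowAt_insert_of_eq_zero {T : Finset (Fin n)} {β : Fin n →₀ ℕ} {j : Fin n}
    (h : β j = 0) : belowAt (insert j T) β = belowAt T β := by
  ext γ
  simp [belowAt, h]

/-- This and `Iic_union_belowAt` describe multiplication by x_j on F/(x_i : i ∈ T)F: its source at γ
and its cokernel at γ + e_j. If j were in `T`, the left side would be all of `Set.Iic γ`. -/
theorem Iic_inter_belowAt {T : Finset (Fin n)} {γ : Fin n →₀ ℕ} {j : Fin n} (hj : j ∉ T) :
    Set.Iic γ ∩ belowAt T (γ + Finsupp.single j 1) = belowAt T γ := by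
  ext δ
  have key : ∀ i ∈ T, (γ + Finsupp.single j 1 : Fin n →₀ ℕ) i = γ i := fun i hi => by
    rw [Finsupp.add_apply, Finsupp.single_eq_of_ne (ne_of_mem_of_not_mem hi hj), add_zero]
  constructor
  · rintro ⟨h, -, i, hi, hlt⟩
    exact ⟨h, i, hi, key i hi ▸ hlt⟩
  · rintro ⟨h, i, hi, hlt⟩
    exact ⟨h, h.trans le_self_add, i, hi, (key i hi).symm ▸ hlt⟩

theorem Iic_union_belowAt {T : Finset (Fin n)} {γ : Fin n →₀ ℕ} {j : Fin n} :
    Set.Iic γ ∪ belowAt T (γ + Finsupp.single j 1) =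
      belowAt (insert j T) (γ + Finsupp.single j 1) := by
  ext δ
  constructor
  · rintro (h | ⟨h, i, hi, hlt⟩)
    · refine ⟨le_trans (show δ ≤ γ from h) le_self_add, j, Finset.mem_insert_self _ _, ?_⟩
      rw [Finsupp.add_apply, Finsupp.single_eq_same]
      exact Nat.lt_succ_of_le (h j)
    · exact ⟨h, i, Finset.mem_insert_of_mem hi, hlt⟩
  · rintro ⟨h, i, hi, hlt⟩
    rcases Finset.mem_insert.1 hi with rfl | hi
    · left
      intro l
      by_cases hl : l = i
      · subst hl
        rw [Finsupp.add_apply, Finsupp.single_eq_same] at hlt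
        exact Nat.le_of_lt_succ hlt
      · have := h l
        rwa [Finsupp.add_apply, Finsupp.single_eq_of_ne hl, add_zero] at this
    · exact Or.inr ⟨h, i, hi, hlt⟩

variable {k : Type u} [Field k] {M : Ideal (MvPolynomial (Fin n) k)}

namespace FreeResolution

variable (F : FreeResolution.{w, u} M)

/-- The part of multidegree `β` of `F / (x_j : j ∈ T) F` has no homology in degree `i`. -/
def KoszulAcyclicAt (T : Finset (Fin n)) (β : Fin n →₀ ℕ) (i : ℕ) : Prop :=
  RelAcyclicAt F.coeffD (F.strand (Set.Iic β)) (F.strand (belowAt T β)) i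

/-- The part of multidegree `β` of `F / (x_j : j ∈ T) F` has one-dimensional homology in
degree `i`. -/
def KoszulOneDimAt (T : Finset (Fin n)) (β : Fin n →₀ ℕ) (i : ℕ) : Prop :=
  RelOneDimAt F.coeffD (F.strand (Set.Iic β)) (F.strand (belowAt T β)) i

theorem koszulAcyclicAt_empty (β : Fin n →₀ ℕ) (i : ℕ) : F.KoszulAcyclicAt ∅ β (i + 1) := by
  rw [KoszulAcyclicAt, belowAt_empty]
  exact F.relAcyclicAt_Iic β i

variable {F}

theorem strand_sup_belowAt (T : Finset (Fin n)) (γ : Fin n →₀ ℕ) (j : Fin n) :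
    F.strand (Set.Iic γ) ⊔ F.strand (belowAt T (γ + Finsupp.single j 1)) =
      F.strand (belowAt (insert j T) (γ + Finsupp.single j 1)) := by
  rw [strand_sup, Iic_union_belowAt]

theorem strand_inf_belowAt {T : Finset (Fin n)} (γ : Fin n →₀ ℕ) {j : Fin n} (hj : j ∉ T) :
    F.strand (Set.Iic γ) ⊓ F.strand (belowAt T (γ + Finsupp.single j 1)) =
      F.strand (belowAt T γ) := by
  rw [strand_inf, Iic_inter_belowAt hj]

theorem strand_Iic_le_add (γ δ : Fin n →₀ ℕ) :
    F.strand (Set.Iic γ) ≤ F.strand (Set.Iic (γ + δ)) :=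
  F.strand_mono (Set.Iic_subset_Iic.2 le_self_add)

theorem KoszulAcyclicAt.insert_of_eq_zero {T : Finset (Fin n)} {β : Fin n →₀ ℕ} {j : Fin n}
    {i : ℕ} (h : β j = 0) (hT : F.KoszulAcyclicAt T β i) : F.KoszulAcyclicAt (insert j T) β i := by
  rwa [KoszulAcyclicAt, belowAt_insert_of_eq_zero h]

theorem KoszulAcyclicAt.insert_succ {T : Finset (Fin n)} {γ : Fin n →₀ ℕ} {j : Fin n} (hj : j ∉ T)
    {i : ℕ} (h : F.KoszulAcyclicAt T (γ + Finsupp.single j 1) (i + 1))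
    (h' : F.KoszulAcyclicAt T γ i) :
    F.KoszulAcyclicAt (insert j T) (γ + Finsupp.single j 1) (i + 1) := by
  rw [KoszulAcyclicAt, ← strand_sup_belowAt]
  refine .of_acyclic F.coeffD_comp_coeffD (F.coeffD_mem_strand (isLowerSet_Iic _))
    (F.coeffD_mem_strand (isLowerSet_belowAt _ _)) (strand_Iic_le_add _ _) h ?_
  rwa [strand_inf_belowAt _ hj]

theorem KoszulAcyclicAt.insert_zero {T : Finset (Fin n)} {γ : Fin n →₀ ℕ} {j : Fin n}
    (h : F.KoszulAcyclicAt T (γ + Finsupp.single j 1) 0) :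
    F.KoszulAcyclicAt (insert j T) (γ + Finsupp.single j 1) 0 := by
  rw [KoszulAcyclicAt, ← strand_sup_belowAt]
  exact .zero_sup h

theorem KoszulOneDimAt.insert_succ {T : Finset (Fin n)} {γ : Fin n →₀ ℕ} {j : Fin n} (hj : j ∉ T)
    {i : ℕ} (h : ∀ i, F.KoszulAcyclicAt T (γ + Finsupp.single j 1) i)
    (h' : F.KoszulOneDimAt T γ i) :
    F.KoszulOneDimAt (insert j T) (γ + Finsupp.single j 1) (i + 1) := by
  rw [KoszulOneDimAt, ← strand_sup_belowAt]
  refine .succ_sup F.coeffD_comp_coeffD (F.coeffD_mem_strand (isLowerSet_Iic _))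
    (F.coeffD_mem_strand (isLowerSet_belowAt _ _)) (strand_Iic_le_add _ _) (h i) (h (i + 1)) ?_
  rwa [strand_inf_belowAt _ hj]

theorem eq_zero_or_exists_add_single (β : Fin n →₀ ℕ) (j : Fin n) :
    β j = 0 ∨ ∃ γ, β = γ + Finsupp.single j 1 := by
  refine (Nat.eq_zero_or_pos (β j)).imp_right fun h => ⟨β - Finsupp.single j 1, ?_⟩
  exact (tsub_add_cancel_of_le (Finsupp.single_le_iff.2 h)).symm

/-- Each killed variable raises the top homological degree by at most one. -/
theorem koszulAcyclicAt_of_card_lt (T : Finset (Fin n)) :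
    ∀ (β : Fin n →₀ ℕ) (i : ℕ), T.card < i → F.KoszulAcyclicAt T β i := by
  classical
  induction T using Finset.induction_on with
  | empty =>
    rintro β (_ | i) hi
    · exact absurd hi (lt_irrefl _)
    · exact F.koszulAcyclicAt_empty β i
  | insert j T hj ih =>
    intro β i hi
    rw [Finset.card_insert_of_notMem hj] at hi
    obtain h0 | ⟨γ, rfl⟩ := eq_zero_or_exists_add_single β j
    · exact (ih β i (by omega)).insert_of_eq_zero h0
    · obtain ⟨i, rfl⟩ : ∃ l, i = l + 1 := ⟨i - 1, by omega⟩
      exact .insert_succ hj (ih _ _ (by omega)) (ih _ _ (by omega))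

/-- The homology in question is the kernel of x_j : (S/M)_γ → (S/M)_{γ+e_j}. It vanishes if the
source is zero, or if the target is nonzero, the map then being injective. -/
theorem koszulAcyclicAt_singleton {γ : Fin n →₀ ℕ} {j : Fin n}
    (h : monomial γ (1 : k) ∈ M ∨ monomial (γ + Finsupp.single j 1) (1 : k) ∉ M) :
    F.KoszulAcyclicAt {j} (γ + Finsupp.single j 1) 1 := by
  rw [← insert_empty_eq]
  rcases h with h | h
  · refine .insert_succ (Finset.notMem_empty j) (F.koszulAcyclicAt_empty _ _) ?_
    rw [KoszulAcyclicAt, belowAt_empty]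
    exact F.relAcyclicAt_zero_Iic h
  · rw [KoszulAcyclicAt, ← strand_sup_belowAt]
    refine .of_injective F.coeffD_comp_coeffD (F.coeffD_mem_strand (isLowerSet_Iic _))
      (F.coeffD_mem_strand (isLowerSet_belowAt _ _)) (strand_Iic_le_add _ _)
      (F.koszulAcyclicAt_empty _ _) ?_
    rintro a ha - ⟨z, hz, haz⟩
    have hbot : F.strand ∅ 1 = ⊥ := Finsupp.supported_empty
    rw [belowAt_empty, hbot] at haz
    obtain rfl : a = F.coeffD 1 z := sub_eq_zero.1 ((Submodule.mem_bot k).1 haz)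
    -- Being a boundary at γ + e_j, where S/M is nonzero, forces zero augmentation; hence `a` is
    -- already a boundary at γ.
    have h0 := eq_zero_of_monomial_mem h (F.monomial_augCoeff_coeffD hz)
    obtain ⟨w, hw, hwa⟩ := F.mem_range_coeffD ha (by rw [h0, map_zero]; exact zero_mem _)
    refine ⟨w, hw, ?_⟩
    rw [hwa, sub_self]
    exact zero_mem _

/-- Killing j first yields the condition on x_j. Each further variable l only shifts the multidegree
by e_l, since homology above the number of killed variables vanishes and the connecting map is
injective on the top homology. -/
theorem exists_of_not_koszulAcyclicAt_insert {j : Fin n} (T : Finset (Fin n)) :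
    j ∉ T → ∀ β : Fin n →₀ ℕ, ¬ F.KoszulAcyclicAt (insert j T) β (T.card + 1) →
      ∃ γ, β = γ + squarefreeMonomial (insert j T) ∧ monomial γ (1 : k) ∉ M ∧
        monomial (γ + Finsupp.single j 1) (1 : k) ∈ M := by
  classical
  induction T using Finset.induction_on with
  | empty =>
    intro hj β h
    obtain h0 | ⟨γ, rfl⟩ := eq_zero_or_exists_add_single β j
    · exact absurd ((F.koszulAcyclicAt_empty β 0).insert_of_eq_zero h0) h
    · by_contra hcon
      refine h (koszulAcyclicAt_singleton ?_)
      by_contra! h'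
      exact hcon ⟨γ, by simp [squarefreeMonomial], h'⟩
  | insert l T hl ih =>
    intro hj β h
    have hlj : l ∉ insert j T := by
      rw [Finset.mem_insert, not_or]
      exact ⟨fun h => hj (h ▸ Finset.mem_insert_self _ _), hl⟩
    have hjT : j ∉ T := fun h => hj (Finset.mem_insert_of_mem h)
    have hcard : (insert j T).card = T.card + 1 := Finset.card_insert_of_notMem hjT
    rw [Finset.insert_comm, Finset.card_insert_of_notMem hl] at h
    have hvan : ∀ β, F.KoszulAcyclicAt (insert j T) β (T.card + 1 + 1) := fun β =>
      koszulAcyclicAt_of_card_lt _ _ _ (by omega)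
    obtain h0 | ⟨γ, rfl⟩ := eq_zero_or_exists_add_single β l
    · exact absurd ((hvan β).insert_of_eq_zero h0) h
    · obtain ⟨δ, rfl, hδ⟩ := ih hjT γ fun h' => h (.insert_succ hlj (hvan _) h')
      refine ⟨δ, ?_, hδ⟩
      rw [Finset.insert_comm, squarefreeMonomial_insert hlj]
      abel

theorem monomial_add_mem {γ : Fin n →₀ ℕ} (h : monomial γ (1 : k) ∈ M) (δ : Fin n →₀ ℕ) :
    monomial (γ + δ) (1 : k) ∈ M := by
  have := M.mul_mem_right (monomial δ 1) h
  rwa [monomial_mul, mul_one] at this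

/-- Once x^γ ∈ M, S/M vanishes at every multiple of x^γ, so F is exact at all multidegrees the
induction meets. -/
theorem koszulAcyclicAt_of_mem (T : Finset (Fin n)) :
    ∀ γ : Fin n →₀ ℕ, monomial γ (1 : k) ∈ M →
      ∀ i, F.KoszulAcyclicAt T (γ + squarefreeMonomial T) i := by
  classical
  induction T using Finset.induction_on with
  | empty =>
    rintro γ h (_ | i)
    · rw [squarefreeMonomial, Finset.sum_empty, add_zero, KoszulAcyclicAt, belowAt_empty]
      exact F.relAcyclicAt_zero_Iic h
    · exact F.koszulAcyclicAt_empty _ i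
  | insert j T hj ih =>
    intro γ h i
    have h1 : γ + squarefreeMonomial (insert j T) =
        γ + squarefreeMonomial T + Finsupp.single j 1 := by
      rw [squarefreeMonomial_insert hj]; abel
    have h2 := ih (γ + Finsupp.single j 1) (monomial_add_mem h _)
    rw [add_right_comm] at h2
    rw [h1]
    obtain _ | i := i
    · exact (h2 0).insert_zero
    · exact .insert_succ hj (h2 _) (ih γ h i)

/-- At each step the middle term of the long exact sequence is acyclic by `koszulAcyclicAt_of_mem`,
so the connecting map carries the homology of S/M at γ up one degree per variable. -/
theorem koszul_of_socle {G : Finset (Fin n →₀ ℕ)} (hG : monomialIdeal k (G : Set _) = M)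
    {γ : Fin n →₀ ℕ} (hγ : monomial γ (1 : k) ∉ M) (T : Finset (Fin n)) :
    (∀ j ∈ T, monomial (γ + Finsupp.single j 1) (1 : k) ∈ M) →
      F.KoszulOneDimAt T (γ + squarefreeMonomial T) T.card ∧
        ∀ i ≠ T.card, F.KoszulAcyclicAt T (γ + squarefreeMonomial T) i := by
  classical
  induction T using Finset.induction_on with
  | empty =>
    intro _
    refine ⟨?_, ?_⟩
    · rw [squarefreeMonomial, Finset.sum_empty, add_zero, KoszulOneDimAt, belowAt_empty]
      exact F.relOneDimAt_zero_Iic hG hγ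
    · rintro (_ | i) hi
      · exact absurd rfl hi
      · exact F.koszulAcyclicAt_empty _ i
  | insert j T hj ih =>
    intro h
    obtain ⟨ih1, ih2⟩ := ih fun l hl => h l (Finset.mem_insert_of_mem hl)
    have h1 : γ + squarefreeMonomial (insert j T) =
        γ + squarefreeMonomial T + Finsupp.single j 1 := by
      rw [squarefreeMonomial_insert hj]; abel
    have h2 := F.koszulAcyclicAt_of_mem T (γ + Finsupp.single j 1)
      (h j (Finset.mem_insert_self _ _))
    rw [add_right_comm] at h2
    rw [h1, Finset.card_insert_of_notMem hj]
    refine ⟨ih1.insert_succ hj h2, ?_⟩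
    rintro (_ | i) hi
    · exact (h2 0).insert_zero
    · exact .insert_succ hj (h2 _) (ih2 i fun h => hi (by rw [h]))

/-! ### Minimality: reading basis elements off the homology. -/

theorem IsMinimal.coeffD_mem_belowAt (hF : F.IsMinimal) {β : Fin n →₀ ℕ} (i : ℕ)
    {z : F.shiftedBasis (i + 1) →₀ k} (hz : z ∈ F.strand (Set.Iic β) (i + 1)) :
    F.coeffD i z ∈ F.strand (belowAt Finset.univ β) i :=
  hF.coeffD_mem_strand
    (fun _ hγ _ hlt => lt_iff_mem_belowAt_univ.2 (hlt.trans_le hγ)) i z hz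

theorem single_mem_strand {i : ℕ} {P : Set (Fin n →₀ ℕ)} {σ : F.basis i} (h : F.mdeg σ ∈ P) :
    (Finsupp.single σ 1 : F.basis i →₀ k) ∈ F.strand P (i + 1) :=
  Finsupp.single_mem_supported _ _ h

theorem IsMinimal.mdeg_ne_of_koszulAcyclicAt (hF : F.IsMinimal) {β : Fin n →₀ ℕ} {i : ℕ}
    (h : F.KoszulAcyclicAt Finset.univ β i) (σ : F.basis i) : F.mdeg σ ≠ β := by
  rintro rfl
  have hσ := single_mem_strand (k := k) (F := F) (σ := σ) (Set.mem_Iic.2 le_rfl)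
  obtain ⟨w, hw, hσw⟩ := h _ hσ (hF.coeffD_mem_belowAt i hσ)
  have h2 := (Submodule.sub_mem_iff_left _ (hF.coeffD_mem_belowAt (i + 1) hw)).1 hσw
  have h3 := (Finsupp.mem_supported' k _).1 h2 σ
    (fun h : F.mdeg σ ∈ _ => lt_irrefl _ (lt_iff_mem_belowAt_univ.1 h))
  exact one_ne_zero ((Finsupp.single_eq_same (a := σ)).symm.trans h3)

theorem IsMinimal.existsUnique_of_koszulOneDimAt (hF : F.IsMinimal) {β : Fin n →₀ ℕ} {i : ℕ}
    (h : F.KoszulOneDimAt Finset.univ β i) : ∃! σ : F.basis i, F.mdeg σ = β := by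
  classical
  obtain ⟨(z : F.basis i →₀ k), hz, -, hzb, hgen⟩ := h
  have hz' : ∀ σ : F.basis i, ¬ F.mdeg σ ≤ β → z σ = 0 := fun σ hσ =>
    (Finsupp.mem_supported' k z).1 hz σ hσ
  -- Boundaries lie in strictly smaller multidegrees, so at multidegree β each basis vector is
  -- itself a multiple of `z`, with no correction term.
  have hgen' : ∀ σ : F.basis i, F.mdeg σ = β → ∃ c : k,
      ∀ τ : F.basis i, F.mdeg τ = β → Finsupp.single σ (1 : k) τ = c * z τ := by
    intro σ hσ
    have hσ' := single_mem_strand (k := k) (F := F) (σ := σ) (Set.mem_Iic.2 hσ.le)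
    obtain ⟨c, w, hw, hcw⟩ := hgen _ hσ' (hF.coeffD_mem_belowAt i hσ')
    have h2 := (Submodule.sub_mem_iff_left _ (hF.coeffD_mem_belowAt (i + 1) hw)).1 hcw
    refine ⟨c, fun τ hτ => ?_⟩
    have h3 := (Finsupp.mem_supported' k _).1 h2 τ
      (fun h : F.mdeg τ ∈ _ => (lt_iff_mem_belowAt_univ.1 h).ne hτ)
    exact sub_eq_zero.1 h3
  have hex : ∃ σ : F.basis i, F.mdeg σ = β := by
    by_contra! hne
    refine hzb 0 (zero_mem _) ((Submodule.sub_mem_iff_left _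
      (hF.coeffD_mem_belowAt (i + 1) (zero_mem _))).2 ?_)
    refine (Finsupp.mem_supported' k _).2 fun (σ : F.basis i) hσ => hz' σ fun hle => hσ ?_
    exact lt_iff_mem_belowAt_univ.2 (lt_of_le_of_ne hle (hne σ))
  obtain ⟨σ, hσ⟩ := hex
  refine ⟨σ, hσ, fun τ hτ => ?_⟩
  by_contra hne
  obtain ⟨c, hc⟩ := hgen' σ hσ
  obtain ⟨c', hc'⟩ := hgen' τ hτ
  have e1 := hc σ hσ
  have e2 := hc τ hτ
  have e3 := hc' τ hτ
  rw [Finsupp.single_eq_same] at e1 e3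
  rw [Finsupp.single_eq_of_ne hne] at e2
  rcases mul_eq_zero.1 e2.symm with h | h
  · simp [h] at e1
  · simp [h] at e3

theorem IsMinimal.exists_socle (hF : F.IsMinimal) (hn : 1 ≤ n) (σ : F.basis n) :
    ∃ γ, γ + squarefreeMonomial Finset.univ = F.mdeg σ ∧ monomial γ (1 : k) ∉ M ∧
      ∀ j, monomial (γ + Finsupp.single j 1) (1 : k) ∈ M := by
  classical
  have key : ∀ j : Fin n, ∃ γ, F.mdeg σ = γ + squarefreeMonomial Finset.univ ∧
      monomial γ (1 : k) ∉ M ∧ monomial (γ + Finsupp.single j 1) (1 : k) ∈ M := by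
    intro j
    have hins : insert j (Finset.univ.erase j) = Finset.univ :=
      Finset.insert_erase (Finset.mem_univ j)
    have hcard : (Finset.univ.erase j).card + 1 = n := by
      rw [Finset.card_erase_add_one (Finset.mem_univ j), Finset.card_univ, Fintype.card_fin]
    have := exists_of_not_koszulAcyclicAt_insert (F := F) _ (Finset.notMem_erase j Finset.univ)
      (F.mdeg σ)
    rw [hins, hcard] at this
    exact this fun h => hF.mdeg_ne_of_koszulAcyclicAt h σ rfl
  obtain ⟨γ, h, hγ, -⟩ := key ⟨0, hn⟩
  refine ⟨γ, h.symm, hγ, fun j => ?_⟩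
  obtain ⟨γ', h', -, hj⟩ := key j
  -- Every choice of j gives the same γ, because γ is determined by the multidegree of σ.
  rwa [add_right_cancel (h.symm.trans h')]

end FreeResolution

/-! ### Socle monomials and dominant sets. -/

theorem exists_dominant_of_socle {G : Finset (Fin n →₀ ℕ)} (hG : monomialIdeal k (G : Set _) = M)
    {γ β : Fin n →₀ ℕ} (hβ : γ + squarefreeMonomial Finset.univ = β)
    (hγ : monomial γ (1 : k) ∉ M) (hsoc : ∀ j, monomial (γ + Finsupp.single j 1) (1 : k) ∈ M) :
    ∃ L : Finset (Fin n →₀ ℕ), L ⊆ G ∧ IsDominantSet L ∧ L.card = n ∧ lcm L = β ∧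
      ∀ m ∈ G, ¬ StronglyDivides m (lcm L) := by
  classical
  have hβ' : ∀ l, β l = γ l + 1 := fun l => by
    rw [← hβ, Finsupp.add_apply, squarefreeMonomial_apply, if_pos (Finset.mem_univ l)]
  have hno : ∀ g ∈ G, ¬ g ≤ γ := fun g hg hle => hγ ((monomial_mem_iff hG).2 ⟨g, hg, hle⟩)
  choose g hgG hg using fun j => (monomial_mem_iff hG).1 (hsoc j)
  have hne : ∀ j l, l ≠ j → g j l ≤ γ l := fun j l hl => by
    have := hg j l
    rwa [Finsupp.add_apply, Finsupp.single_eq_of_ne hl, add_zero] at this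
  -- Otherwise `g j` would divide x^γ, which is not in M.
  have heq : ∀ j, g j j = γ j + 1 := fun j => by
    have h1 := hg j j
    rw [Finsupp.add_apply, Finsupp.single_eq_same] at h1
    refine le_antisymm h1 (Nat.succ_le_of_lt (lt_of_not_ge fun h2 => hno _ (hgG j) fun l => ?_))
    by_cases hl : l = j
    · exact hl ▸ h2
    · exact hne j l hl
  have hinj : Function.Injective g := fun i j hij => by
    by_contra h
    have h1 := hne j i h
    rw [← hij, heq i] at h1
    omega
  have hlcm : lcm (Finset.univ.image g) = β := by
    refine le_antisymm (Finset.sup_le fun m hm => ?_) fun l => ?_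
    · obtain ⟨j, -, rfl⟩ := Finset.mem_image.1 hm
      intro l
      rw [hβ']
      by_cases hl : l = j
      · exact hl ▸ (heq l).le
      · exact (hne j l hl).trans (Nat.le_succ _)
    · rw [hβ', ← heq]
      exact Finset.le_sup (f := id) (Finset.mem_image_of_mem g (Finset.mem_univ l)) l
  refine ⟨Finset.univ.image g, ?_, ?_, ?_, hlcm, ?_⟩
  · intro m hm
    obtain ⟨j, -, rfl⟩ := Finset.mem_image.1 hm
    exact hgG j
  · intro m hm
    refine ⟨hm, ?_⟩
    obtain ⟨j, -, rfl⟩ := Finset.mem_image.1 hm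
    refine ⟨j, fun m' hm' hmm => ?_⟩
    obtain ⟨l, -, rfl⟩ := Finset.mem_image.1 hm'
    rw [heq]
    exact Nat.lt_succ_of_le (hne l j fun h => hmm (by rw [h]))
  · rw [Finset.card_image_of_injective _ hinj, Finset.card_univ, Fintype.card_fin]
  · intro m hm hs
    refine hno m hm fun l => ?_
    by_cases h0 : m l = 0
    · simp [h0]
    · have := hs l h0
      rw [hlcm, hβ'] at this
      exact Nat.le_of_lt_succ this

/-- Distinct elements cannot dominate in the same variable, so n elements use each of the n
variables exactly once. -/
theorem IsDominantSet.exists_injective {L : Finset (Fin n →₀ ℕ)} (h : IsDominantSet L)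
    (hcard : L.card = n) : ∃ g : Fin n → Fin n →₀ ℕ, Function.Injective g ∧
      ∀ j, g j ∈ L ∧ ∀ m ∈ L, m ≠ g j → m j < g j j := by
  classical
  choose f hf using fun m : L => (h m m.2).2
  have hinj : Function.Injective f := fun m m' heq => by
    by_contra hne
    have hne' : (m : Fin n →₀ ℕ) ≠ m' := fun h => hne (Subtype.ext h)
    have h1 := hf m m' m'.2 hne'.symm
    have h2 := hf m' m m.2 hne'
    rw [heq] at h1
    exact lt_asymm h1 h2
  have hbij := (Fintype.bijective_iff_injective_and_card f).2
    ⟨hinj, by rw [Fintype.card_coe, Fintype.card_fin, hcard]⟩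
  let e := Equiv.ofBijective f hbij
  refine ⟨fun j => e.symm j, Subtype.val_injective.comp e.symm.injective, fun j =>
    ⟨(e.symm j).2, fun m hm hne => ?_⟩⟩
  have := hf (e.symm j) m hm hne
  rwa [show f (e.symm j) = j from e.apply_symm_apply j] at this

theorem exists_socle_of_dominant {G L : Finset (Fin n →₀ ℕ)}
    (hG : monomialIdeal k (G : Set _) = M) (hL : L ⊆ G) (hdom : IsDominantSet L)
    (hcard : L.card = n) (hstr : ∀ m ∈ G, ¬ StronglyDivides m (lcm L)) :
    ∃ γ, γ + squarefreeMonomial Finset.univ = lcm L ∧ monomial γ (1 : k) ∉ M ∧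
      ∀ j, monomial (γ + Finsupp.single j 1) (1 : k) ∈ M := by
  classical
  obtain ⟨g, hinj, hg'⟩ := hdom.exists_injective hcard
  have hgL := fun j => (hg' j).1
  have hg := fun j => (hg' j).2
  have hle : ∀ m ∈ L, m ≤ lcm L := fun m hm => Finset.le_sup (f := id) hm
  have hlcm : ∀ j, lcm L j = g j j := by
    intro j
    have hsup : lcm L j = L.sup fun m => m j :=
      Finset.apply_sup_eq_sup_comp (fun m : Fin n →₀ ℕ => m j) (fun _ _ => rfl) rfl
    refine le_antisymm ?_ (hle _ (hgL j) j)
    rw [hsup]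
    refine Finset.sup_le fun m hm => ?_
    by_cases h : m = g j
    · rw [h]
    · exact (hg j m hm h).le
  -- A zero exponent at j leaves no room for a second element of `L`, so n ≤ 1 and the only
  -- generator in `L` is the monomial 1, which strongly divides everything vacuously.
  have hpos : ∀ j, lcm L j ≠ 0 := by
    intro j h0
    have hall : ∀ m ∈ L, m = g j := fun m hm => by
      by_contra h
      have := hg j m hm h
      rw [← hlcm, h0] at this
      exact Nat.not_lt_zero _ this
    have hc : Fintype.card (Fin n) ≤ 1 := by
      rw [Fintype.card_fin, ← hcard]
      exact Finset.card_le_one.2 fun a ha b hb => (hall a ha).trans (hall b hb).symm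
    refine hstr _ (hL (hgL j)) fun l hl => absurd ?_ hl
    rw [Fintype.card_le_one_iff.1 hc l j, ← hlcm, h0]
  have hone : squarefreeMonomial Finset.univ ≤ lcm L := fun l => by
    rw [squarefreeMonomial_apply, if_pos (Finset.mem_univ l)]
    exact Nat.one_le_iff_ne_zero.2 (hpos l)
  obtain ⟨γ, hγ⟩ := exists_add_of_le hone
  rw [add_comm] at hγ
  have hval : ∀ l, lcm L l = γ l + 1 := fun l => by
    rw [hγ, Finsupp.add_apply, squarefreeMonomial_apply, if_pos (Finset.mem_univ l)]
  refine ⟨γ, hγ.symm, fun hmem => ?_, fun j => (monomial_mem_iff hG).2 ⟨g j, hL (hgL j), ?_⟩⟩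
  · obtain ⟨m, hm, hmγ⟩ := (monomial_mem_iff hG).1 hmem
    refine hstr m hm fun l _ => ?_
    rw [hval]
    exact Nat.lt_succ_of_le (hmγ l)
  · intro l
    by_cases hl : l = j
    · subst hl
      rw [Finsupp.add_apply, Finsupp.single_eq_same, ← hval, hlcm]
    · rw [Finsupp.add_apply, Finsupp.single_eq_of_ne hl, add_zero, ← Nat.lt_succ_iff,
        Nat.succ_eq_add_one, ← hval, hlcm]
      refine hg l _ (hgL j) fun h => hl (hinj h).symm

end MonomialRes

open MonomialRes MvPolynomial in
theorem mainTheorem8 {k : Type u} [Field k] (n : ℕ) (hn : 1 ≤ n)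
    (M : Ideal (MvPolynomial (Fin n) k)) (G : Finset (Fin n →₀ ℕ))
    (hG : MonomialRes.IsMinimallyGeneratedBy M G)
    (F : MonomialRes.FreeResolution.{w, u} M) (hF : F.IsMinimal) :
    (∀ σ : F.basis n, ∃ L : Finset (Fin n →₀ ℕ), L ⊆ G ∧
        MonomialRes.IsDominantSet L ∧ L.card = n ∧ MonomialRes.lcm L = F.mdeg σ ∧
        ∀ m ∈ G, ¬ MonomialRes.StronglyDivides m (MonomialRes.lcm L)) ∧
    (∀ L : Finset (Fin n →₀ ℕ), L ⊆ G → MonomialRes.IsDominantSet L → L.card = n →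
        (∀ m ∈ G, ¬ MonomialRes.StronglyDivides m (MonomialRes.lcm L)) →
        ∃ σ : F.basis n, F.mdeg σ = MonomialRes.lcm L ∧
          ∀ (i : ℕ) (τ : F.basis i), (⟨i, τ⟩ : Σ j, F.basis j) ≠ ⟨n, σ⟩ →
            F.mdeg τ ≠ MonomialRes.lcm L) := by
  classical
  refine ⟨fun σ => ?_, fun L hL hdom hcard hstr => ?_⟩
  · obtain ⟨γ, hγ, hγM, hsoc⟩ := hF.exists_socle hn σ
    exact exists_dominant_of_socle hG.1 hγ hγM hsoc
  · obtain ⟨γ, hγ, hγM, hsoc⟩ := exists_socle_of_dominant (k := k) hG.1 hL hdom hcard hstr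
    obtain ⟨h1, h2⟩ := F.koszul_of_socle hG.1 hγM Finset.univ fun j _ => hsoc j
    rw [hγ, Finset.card_univ, Fintype.card_fin] at h1 h2
    obtain ⟨σ, hσ, huniq⟩ := hF.existsUnique_of_koszulOneDimAt h1
    refine ⟨σ, hσ, fun i τ hne hτ => ?_⟩
    by_cases hi : i = n
    · subst hi
      exact hne (by rw [huniq τ hτ])
    · exact hF.mdeg_ne_of_koszulAcyclicAt (h2 i hi) τ hτ
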